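/- Let $K$ be an algebraically closed field of characteristic $0$. For points $p_0,\dots,p_8\in\mathbb{P}^3_K$, write $\mathbb{L}_3(d,m,k^8)$ for the linear system of all surfaces of degree $d$ in $\mathbb{P}^3$ with multiplicity at least $m$ at $p_0$ and at least $k$ at each of $p_1,\dots,p_8$. If $p_0,\dots,p_8$ are general (that is, for all $(p_0,\dots,p_8)$ in some nonempty Zariski open subset of $(\mathbb{P}^3)^9$), then there is exactly one quadric $Q$ through the nine points, $Q$ is irreducible and is a fixed component of the (nonempty) system $\mathbb{L}_3(9,6,4^8)$, and $$\mathbb{L}_3(9,6,4^8)=Q+\mathbb{L}_3(7,5,3^8),$$ i.e. the members of $\mathbb{L}_3(9,6,4^8)$ are exactly the divisors $Q+D$ with $D\in\mathbb{L}_3(7,5,3^8)$. -/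

import Mathlib

namespace FatPoints

/-- Points of the projective space `ℙⁿ` over `K`, i.e. lines through the origin of `Kⁿ⁺¹`. -/
abbrev ProjPoint (K : Type*) [Field K] (n : ℕ) : Type _ :=
  Projectivization K (Fin (n + 1) → K)

/-- The hypersurface `F = 0` has multiplicity at least `m` at the point `p`: all terms of degree
`< m` in the Taylor expansion `F (v + X)` at a vector `v` representing `p` vanish. For a form `F`
this does not depend on `v`, and the order of `F (v + X)` is the multiplicity at `p` of the
hypersurface, since its affine cone is, near `v`, the product of the hypersurface with a line. -/
def HasMultAtLeast {K : Type*} [Field K] {n : ℕ} (F : MvPolynomial (Fin (n + 1)) K)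
    (p : ProjPoint K n) (m : ℕ) : Prop :=
  ∀ e : Fin (n + 1) →₀ ℕ, e.degree < m →
    MvPolynomial.coeff e
      (MvPolynomial.aeval
        (fun j => MvPolynomial.C (p.rep j) + MvPolynomial.X j : Fin (n + 1) →
          MvPolynomial (Fin (n + 1)) K) F) = 0

/-- The linear system of hypersurfaces of degree `d` in `ℙⁿ` having multiplicity at least `m i` at
the point `p i` for every `i`, given by the vector space of the forms defining its members:
the members of the system are the hypersurfaces `F = 0` with `F ≠ 0` in this space, two forms
defining the same member exactly when they are proportional. -/
noncomputable def linearSystem {K : Type*} [Field K] {n r : ℕ} (p : Fin r → ProjPoint K n) (d : ℕ)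
    (m : Fin r → ℕ) : Submodule K (MvPolynomial (Fin (n + 1)) K) where
  carrier := {F | F.IsHomogeneous d ∧ ∀ i, HasMultAtLeast F (p i) (m i)}
  zero_mem' := ⟨MvPolynomial.isHomogeneous_zero _ _ _, fun i e _ => by simp⟩
  add_mem' := fun {F G} hF hG => ⟨hF.1.add hG.1, fun i e he => by
    rw [map_add, MvPolynomial.coeff_add, hF.2 i e he, hG.2 i e he, add_zero]⟩
  smul_mem' := fun c F hF =>
    ⟨(MvPolynomial.homogeneousSubmodule (Fin (n + 1)) K d).smul_mem c hF.1, fun i e he => by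
      rw [map_smul, MvPolynomial.coeff_smul, hF.2 i e he, smul_zero]⟩

/-- The system `Q + M`, where `Q` is the hypersurface `q = 0`: its members are the divisors
`Q + D` with `D` a member of `M`, i.e. they are given by the products `q * G` with `G` in `M`. -/
noncomputable def addFixed {K : Type*} [Field K] {n : ℕ} (q : MvPolynomial (Fin (n + 1)) K)
    (M : Submodule K (MvPolynomial (Fin (n + 1)) K)) :
    Submodule K (MvPolynomial (Fin (n + 1)) K) :=
  M.map (LinearMap.mulLeft K q)

/-- The irreducible hypersurface `q = 0` is a fixed component of the (nonempty) linear system `L`: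
it is a component of every member of `L`. -/
def IsFixedComponent {K : Type*} [Field K] {n : ℕ} (q : MvPolynomial (Fin (n + 1)) K)
    (L : Submodule K (MvPolynomial (Fin (n + 1)) K)) : Prop :=
  Irreducible q ∧ L ≠ ⊥ ∧ ∀ F ∈ L, q ∣ F

/-- A polynomial in the `r` groups of variables `x i 0, …, x i n` (`i : Fin r`) is
multihomogeneous if it is homogeneous in each of the groups. -/
def IsMultihomogeneous {K : Type*} [Field K] {r n : ℕ}
    (f : MvPolynomial (Fin r × Fin (n + 1)) K) : Prop :=
  ∃ d : Fin r → ℕ, f.IsWeightedHomogeneous (fun ij => (Pi.single ij.1 1 : Fin r → ℕ)) d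

/-- Zariski closed subsets of `(ℙⁿ)ʳ`: the zero loci of sets of multihomogeneous polynomials. -/
def IsZariskiClosed {K : Type*} [Field K] {r n : ℕ} (Z : Set (Fin r → ProjPoint K n)) : Prop :=
  ∃ S : Set (MvPolynomial (Fin r × Fin (n + 1)) K), (∀ f ∈ S, IsMultihomogeneous f) ∧
    Z = {p | ∀ f ∈ S, MvPolynomial.eval (fun ij => (p ij.1).rep ij.2) f = 0}

/-- The property `P` holds for `r` general points of `ℙⁿ`: it holds for all `r`-tuples in some
nonempty Zariski open subset of `(ℙⁿ)ʳ`. -/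
def ForGeneralPoints {K : Type*} [Field K] {r n : ℕ} (P : (Fin r → ProjPoint K n) → Prop) : Prop :=
  ∃ Z : Set (Fin r → ProjPoint K n), IsZariskiClosed Z ∧ Z ≠ Set.univ ∧ ∀ p, p ∉ Z → P p

end FatPoints

/-! The theorem is a dimension count. For all points, counting conditions gives dim L(7; 5, 3^8) ≥
120 - 35 - 8·10 = 5 and at least one quadric `q` through the points
(`card_le_finrank_linearSystem_add`). Multiplication by `q` embeds L(7; 5, 3^8) into L(9; 6, 4^8),
so the two agree as soon as dim L(9; 6, 4^8) ≤ 5, one more than the virtual dimension 220 - 56 -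
8·20 = 4.

The bound 5 is semicontinuous, so one example over a finite field suffices: the coordinate points
and five sample points modulo 13. There no nonzero form of the system omits five chosen monomials.
This is the nonvanishing of a maximal minor of the matrix of conditions; the minor is a polynomial
in the points with integer coefficients, so it is nonzero in characteristic 0 too
(`exists_isMultihomogeneous_of_zmod`).

Uniqueness of the quadric also follows from the bound: if `q` and `q'` both pass through the points,
then q·L(7; 5, 3^8) = q'·L(7; 5, 3^8), so q'/q acts on a finite-dimensional space and is equal to an
eigenvalue (`mem_span_of_addFixed_eq`). Irreducibility holds when no four points are coplanar: two
planes contain at most six of the nine points. -/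

namespace PackedElimination

/-! ### Gaussian elimination modulo `p` with each row packed into one natural number. -/

/-- The linear form with coefficients the base `B` digits of `N`, evaluated at a list. -/
def digitForm {k : Type*} [Semiring k] (B : ℕ) : ℕ → List k → k
  | _, [] => 0
  | N, y :: ys => ((N % B : ℕ) : k) * y + digitForm B (N / B) ys

/-- The first `n` digits of `N` in base `B` are at most `M`. -/
def DigitsLE (B M : ℕ) : ℕ → ℕ → Prop
  | 0, _ => True
  | n + 1, N => N % B ≤ M ∧ DigitsLE B M n (N / B)

/-- The number with the given digits in base `B`. -/
def pack (B : ℕ) : List ℕ → ℕ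
  | [] => 0
  | x :: l => x + B * pack B l

/-- Splits off a row whose leading digit is nonzero modulo `p`. -/
def extractPivot (B p : ℕ) : List ℕ → Option (ℕ × ℕ × List ℕ)
  | [] => none
  | N :: R =>
    if N % B % p = 0 then (extractPivot B p R).map fun t => (t.1, t.2.1, N :: t.2.2)
    else some (N % B % p, N / B, R)

/-- Eliminates the leading digit of `N`, using a row with leading digit `a` and further digits
those of `r`. -/
def clearHead (B p a r N : ℕ) : ℕ :=
  a * (N / B) + ((p - 1) * (N % B) % p) * r

/-- Gaussian elimination modulo `p` finds a pivot in each of the first `n` columns. -/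
def hasPivots (B p : ℕ) : ℕ → List ℕ → Bool
  | 0, _ => true
  | n + 1, R =>
    match extractPivot B p R with
    | none => false
    | some t => hasPivots B p n (t.2.2.map (clearHead B p t.1 t.2.1))

/-- No carry occurs in the lowest digit. This is what lets one integer operation act on all entries
of a packed row at once. -/
lemma mul_add_mul_digits {B a c N N' : ℕ} (h : a * (N % B) + c * (N' % B) < B) :
    (a * N + c * N') % B = a * (N % B) + c * (N' % B) ∧
      (a * N + c * N') / B = a * (N / B) + c * (N' / B) := by
  have hB : 0 < B := by omega
  have e : a * N + c * N' =
      (a * (N % B) + c * (N' % B)) + B * (a * (N / B) + c * (N' / B)) := by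
    conv_lhs => rw [← Nat.mod_add_div N B, ← Nat.mod_add_div N' B]
    ring
  rw [e, Nat.add_mul_mod_self_left, Nat.mod_eq_of_lt h, Nat.add_mul_div_left _ _ hB,
    Nat.div_eq_of_lt h, zero_add]
  exact ⟨rfl, rfl⟩

lemma DigitsLE.mono {B M M' : ℕ} (h : M ≤ M') : ∀ {n N : ℕ}, DigitsLE B M n N → DigitsLE B M' n N
  | 0, _, _ => trivial
  | _ + 1, _, hN => ⟨hN.1.trans h, DigitsLE.mono h hN.2⟩

lemma DigitsLE.mul_add_mul {B M a c : ℕ} (hM : (a + c) * M < B) :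
    ∀ {n N N' : ℕ}, DigitsLE B M n N → DigitsLE B M n N' →
      DigitsLE B ((a + c) * M) n (a * N + c * N')
  | 0, _, _, _, _ => trivial
  | n + 1, N, N', hN, hN' => by
    have h : a * (N % B) + c * (N' % B) ≤ (a + c) * M := by
      rw [add_mul]; exact add_le_add (Nat.mul_le_mul_left _ hN.1) (Nat.mul_le_mul_left _ hN'.1)
    obtain ⟨h1, h2⟩ := mul_add_mul_digits (h.trans_lt hM)
    exact ⟨h1 ▸ h, h2 ▸ DigitsLE.mul_add_mul hM hN.2 hN'.2⟩

lemma digitForm_mul_add_mul {k : Type*} [CommSemiring k] {B M a c : ℕ} (hM : (a + c) * M < B) :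
    ∀ {x : List k} {N N' : ℕ}, DigitsLE B M x.length N → DigitsLE B M x.length N' →
      digitForm B (a * N + c * N') x = a * digitForm B N x + c * digitForm B N' x
  | [], _, _, _, _ => by simp [digitForm]
  | y :: x, N, N', hN, hN' => by
    have h : a * (N % B) + c * (N' % B) ≤ (a + c) * M := by
      rw [add_mul]; exact add_le_add (Nat.mul_le_mul_left _ hN.1) (Nat.mul_le_mul_left _ hN'.1)
    obtain ⟨h1, h2⟩ := mul_add_mul_digits (h.trans_lt hM)
    simp only [digitForm, h1, h2, digitForm_mul_add_mul hM hN.2 hN'.2]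
    push_cast
    ring

lemma extractPivot_spec {B p : ℕ} : ∀ {R : List ℕ} {t : ℕ × ℕ × List ℕ},
    extractPivot B p R = some t →
      ∃ N ∈ R, t.1 = N % B % p ∧ t.1 ≠ 0 ∧ t.2.1 = N / B ∧ ∀ N' ∈ t.2.2, N' ∈ R
  | [], _, h => by simp [extractPivot] at h
  | N :: R, t, h => by
    rw [extractPivot] at h
    split_ifs at h with h0
    · obtain ⟨s, hs, rfl⟩ := Option.map_eq_some_iff.1 h
      obtain ⟨N', hN', h1, h2, h3, h4⟩ := extractPivot_spec hs
      refine ⟨N', List.mem_cons_of_mem _ hN', h1, h2, h3, fun L hL => ?_⟩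
      rcases List.mem_cons.1 hL with rfl | hL
      · exact List.mem_cons_self
      · exact List.mem_cons_of_mem _ (h4 L hL)
    · obtain rfl := Option.some.inj h
      exact ⟨N, List.mem_cons_self, rfl, h0, rfl, fun L hL => List.mem_cons_of_mem _ hL⟩

/-- Digits are never reduced modulo `p` between steps. Each elimination enlarges their bound by a
factor of at most `2 * p`, so the hypothesis on `B` rules out carries throughout. Back substitution
then kills the unknowns, the last one first. -/
lemma eq_zero_of_hasPivots {B p : ℕ} [Fact p.Prime] :
    ∀ {n M : ℕ} {R : List ℕ}, M * (2 * p) ^ n < B → hasPivots B p n R = true →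
      (∀ N ∈ R, DigitsLE B M n N) → ∀ {x : List (ZMod p)}, x.length = n →
        (∀ N ∈ R, digitForm B N x = 0) → ∀ y ∈ x, y = 0
  | 0, _, _, _, _, _, x, hx, _ => by simp [List.length_eq_zero_iff.1 hx]
  | n + 1, M, R, hM, hR, hb, [], hx, _ => by simp
  | n + 1, M, R, hM, hR, hb, y :: x, hx, h0 => by
    have hp : 0 < p := (Fact.out : p.Prime).pos
    rw [hasPivots] at hR
    split at hR
    · simp at hR
    rename_i t ht
    obtain ⟨N, hN, h1, h2, h3, h4⟩ := extractPivot_spec ht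
    have hx' : x.length = n := by simpa using hx
    have hpow : 1 ≤ (2 * p) ^ n := Nat.one_le_pow _ _ (by omega)
    -- Both multipliers in `clearHead` are residues below `p`; the second represents `-(N' % B)`.
    have hc (N' : ℕ) : t.1 + (p - 1) * (N' % B) % p ≤ 2 * p := by
      have := Nat.mod_lt (N % B) hp
      have := Nat.mod_lt ((p - 1) * (N' % B)) hp
      omega
    have hM' : M * (2 * p) < B := by
      refine lt_of_le_of_lt ?_ hM
      rw [pow_succ]
      exact Nat.mul_le_mul_left _ (Nat.le_mul_of_pos_left _ hpow)
    have hcM (N' : ℕ) : (t.1 + (p - 1) * (N' % B) % p) * M ≤ M * (2 * p) := by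
      rw [mul_comm]; exact Nat.mul_le_mul_left _ (hc N')
    have hNf := h0 N hN
    rw [digitForm] at hNf
    have hp1 : ((p - 1 : ℕ) : ZMod p) = -1 := by
      rw [Nat.cast_sub hp]; simp
    have ha : ((t.1 : ℕ) : ZMod p) = ((N % B : ℕ) : ZMod p) := by rw [h1, ZMod.natCast_mod]
    have hxs : ∀ z ∈ x, z = 0 := by
      refine eq_zero_of_hasPivots (M := M * (2 * p)) ?_ hR ?_ hx' ?_
      · rwa [mul_assoc, ← pow_succ']
      · intro L hL
        obtain ⟨N', hN', rfl⟩ := List.mem_map.1 hL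
        rw [clearHead, h3]
        exact ((hb N' (h4 N' hN')).2.mul_add_mul ((hcM N').trans_lt hM') (hb N hN).2).mono (hcM N')
      · intro L hL
        obtain ⟨N', hN', rfl⟩ := List.mem_map.1 hL
        have hN'f := h0 N' (h4 N' hN')
        rw [digitForm] at hN'f
        rw [clearHead, h3, digitForm_mul_add_mul ((hcM N').trans_lt hM')
          (hx' ▸ (hb N' (h4 N' hN')).2) (hx' ▸ (hb N hN).2), ZMod.natCast_mod, Nat.cast_mul, hp1, ha]
        linear_combination ((N % B : ℕ) : ZMod p) * hN'f - ((N' % B : ℕ) : ZMod p) * hNf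
    -- With the later unknowns zero, the pivot row reduces to a nonzero multiple of `y`.
    have hz : digitForm B (N / B) x = 0 := by
      have : ∀ (l : List (ZMod p)) (L : ℕ), (∀ z ∈ l, z = 0) → digitForm B L l = 0 := by
        intro l
        induction l with
        | nil => intros; rfl
        | cons z l ih =>
          intro L h
          rw [digitForm, ih _ fun w hw => h w (List.mem_cons_of_mem _ hw),
            h z List.mem_cons_self, mul_zero, add_zero]
      exact this x _ hxs
    rw [hz, add_zero, ← ha] at hNf
    have hne : ((t.1 : ℕ) : ZMod p) ≠ 0 := by
      rw [Ne, ZMod.natCast_eq_zero_iff]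
      intro hd
      exact h2 (Nat.eq_zero_of_dvd_of_lt hd (h1 ▸ Nat.mod_lt _ hp))
    intro z hz'
    rcases List.mem_cons.1 hz' with rfl | hz'
    · exact (mul_eq_zero.1 hNf).resolve_left hne
    · exact hxs z hz'

lemma digitsLE_pack {B M : ℕ} (hM : M < B) :
    ∀ {l : List ℕ}, (∀ x ∈ l, x ≤ M) → DigitsLE B M l.length (pack B l)
  | [], _ => trivial
  | x :: l, h => by
    have hx := h x List.mem_cons_self
    rw [pack, List.length_cons, DigitsLE, Nat.add_mul_mod_self_left,
      Nat.mod_eq_of_lt (hx.trans_lt hM), Nat.add_mul_div_left _ _ (by omega),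
      Nat.div_eq_of_lt (hx.trans_lt hM), zero_add]
    exact ⟨hx, digitsLE_pack hM fun y hy => h y (List.mem_cons_of_mem _ hy)⟩

lemma digitForm_pack {k ι : Type*} [Semiring k] {B : ℕ} (f : ι → ℕ) (c : ι → k) :
    ∀ {l : List ι}, (∀ i ∈ l, f i < B) →
      digitForm B (pack B (l.map f)) (l.map c) = (l.map fun i => (f i : k) * c i).sum
  | [], _ => rfl
  | i :: l, h => by
    have hx := h i List.mem_cons_self
    rw [List.map_cons, List.map_cons, List.map_cons, List.sum_cons, pack, digitForm,
      Nat.add_mul_mod_self_left, Nat.mod_eq_of_lt hx, Nat.add_mul_div_left _ _ (by omega),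
      Nat.div_eq_of_lt hx, zero_add, digitForm_pack f c fun j hj => h j (List.mem_cons_of_mem _ hj)]

end PackedElimination

namespace FatPoints

open MvPolynomial

/-! ### The explicit rank computation modulo 13. -/

/-- Exponents of the monomials of degree `9` with multiplicities at least `6, 4, 4, 4` at the
coordinate points, five of them (those divisible by `x₀³x₁⁴`) left out. -/
def exponents : List (ℕ × ℕ × ℕ × ℕ) :=
  (List.range 4).flatMap fun a => (List.range 6).flatMap fun b => (List.range 6).flatMap fun c =>
    if 4 ≤ a + b + c ∧ a + b + c ≤ 9 ∧ ¬ (a = 3 ∧ 4 ≤ b) then [(a, b, c, 9 - a - b - c)] else []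

/-- The exponents of the monomials of degree `3`. -/
def cubicExponents : List (ℕ × ℕ × ℕ × ℕ) :=
  (List.range 4).flatMap fun a => (List.range 4).flatMap fun b => (List.range 4).flatMap fun c =>
    if a + b + c ≤ 3 then [(a, b, c, 3 - a - b - c)] else []

/-- The coefficient of `X ^ e` in `(v + X) ^ a`. -/
def taylorNat (v e a : ℕ × ℕ × ℕ × ℕ) : ℕ :=
  a.1.choose e.1 * v.1 ^ (a.1 - e.1) * (a.2.1.choose e.2.1 * v.2.1 ^ (a.2.1 - e.2.1)) *
    (a.2.2.1.choose e.2.2.1 * v.2.2.1 ^ (a.2.2.1 - e.2.2.1)) *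
    (a.2.2.2.choose e.2.2.2 * v.2.2.2 ^ (a.2.2.2 - e.2.2.2))

/-- Five points of `ℙ³`, to be used together with the four coordinate points. -/
def samplePoints : List (ℕ × ℕ × ℕ × ℕ) :=
  [(1, 1, 1, 1), (1, 2, 5, 1), (1, 3, 1, 4), (1, 4, 4, 6), (1, 4, 2, 1)]

/-- There are 5·20 = 100 equations, from the Taylor coefficients of degree 3 at the sample points,
in 104 - 5 = 99 unknowns; the rank is full. -/
lemma hasPivots_samplePoints :
    PackedElimination.hasPivots ((2 ^ 256) ^ 2) 13 99
      (samplePoints.flatMap fun v => cubicExponents.map fun e =>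
        PackedElimination.pack ((2 ^ 256) ^ 2) (exponents.map fun a => taylorNat v e a % 13)) = true := by
  decide +kernel

lemma eq_zero_of_taylorNat_sum_eq_zero (c : ℕ × ℕ × ℕ × ℕ → ZMod 13)
    (h : ∀ v ∈ samplePoints, ∀ e ∈ cubicExponents,
      (exponents.map fun a => (taylorNat v e a : ZMod 13) * c a).sum = 0) :
    ∀ a ∈ exponents, c a = 0 := by
  have : Fact (Nat.Prime 13) := ⟨by norm_num⟩
  -- Digits start at most 12 and grow by a factor of at most 26 for each of the 99 columns.
  have hb : (12 : ℕ) * (2 * 13) ^ 99 < (2 ^ 256) ^ 2 := by norm_num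
  have hlt (v e a : ℕ × ℕ × ℕ × ℕ) : taylorNat v e a % 13 ≤ 12 :=
    Nat.le_of_lt_succ (Nat.mod_lt _ (by norm_num))
  have hB : 12 < (2 ^ 256) ^ 2 := by norm_num
  have hlen : exponents.length = 99 := by decide +kernel
  have hl (v e : ℕ × ℕ × ℕ × ℕ) : PackedElimination.DigitsLE ((2 ^ 256) ^ 2) 12 99
      (PackedElimination.pack ((2 ^ 256) ^ 2) (exponents.map fun a => taylorNat v e a % 13)) := by
    have := PackedElimination.digitsLE_pack hB
      (l := exponents.map fun a => taylorNat v e a % 13) fun x hx => by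
        obtain ⟨a, -, rfl⟩ := List.mem_map.1 hx; exact hlt v e a
    rwa [List.length_map, hlen] at this
  intro a ha
  refine PackedElimination.eq_zero_of_hasPivots hb hasPivots_samplePoints ?_
    (x := exponents.map c) (by rw [List.length_map, hlen]) ?_ _ (List.mem_map_of_mem ha)
  · intro N hN
    obtain ⟨v, -, hN⟩ := List.mem_flatMap.1 hN
    obtain ⟨e, -, rfl⟩ := List.mem_map.1 hN
    exact hl v e
  · intro N hN
    obtain ⟨v, hv, hN⟩ := List.mem_flatMap.1 hN
    obtain ⟨e, he, rfl⟩ := List.mem_map.1 hN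
    rw [PackedElimination.digitForm_pack _ _ fun a _ => (hlt v e a).trans_lt hB, ← h v hv e he]
    simp only [← ZMod.natCast_mod (taylorNat v e _) 13]

/-! ### Taylor coefficients of monomials. -/

/-- The coefficient of `X ^ e` in `(v + X) ^ a`. -/
def taylorEntry {ι R : Type*} [Fintype ι] [CommSemiring R] (v : ι → R) (e a : ι →₀ ℕ) : R :=
  ∏ j, ((a j).choose (e j) : R) * v j ^ (a j - e j)

lemma map_taylorEntry {ι R S : Type*} [Fintype ι] [CommSemiring R] [CommSemiring S] (φ : R →+* S)
    (v : ι → R) (e a : ι →₀ ℕ) : φ (taylorEntry v e a) = taylorEntry (fun j => φ (v j)) e a := by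
  simp [taylorEntry]

lemma taylorEntry_eq_zero {ι R : Type*} [Fintype ι] [CommSemiring R] (v : ι → R) {e a : ι →₀ ℕ}
    (h : ¬ e ≤ a) : taylorEntry v e a = 0 := by
  obtain ⟨j, hj⟩ := not_forall.1 h
  exact Finset.prod_eq_zero (Finset.mem_univ j) (by simp [Nat.choose_eq_zero_of_lt (not_le.1 hj)])

lemma coeff_prod_C_add_X_pow {ι R : Type*} [Fintype ι] [CommSemiring R] (v : ι → R)
    (e a : ι →₀ ℕ) :
    coeff e (∏ j, (C (v j) + X j : MvPolynomial ι R) ^ a j) = taylorEntry v e a := by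
  classical
  have h1 (j : ι) : (C (v j) + X j : MvPolynomial ι R) ^ a j =
      ∑ k ∈ Finset.range (a j + 1), C (((a j).choose k : R) * v j ^ (a j - k)) * X j ^ k := by
    rw [add_comm, add_pow]
    refine Finset.sum_congr rfl fun k _ => ?_
    simp only [map_mul, map_pow, map_natCast]
    ring
  have h2 (x : ι → ℕ) : ∏ j, (C (((a j).choose (x j) : R) * v j ^ (a j - x j)) * X j ^ x j :
      MvPolynomial ι R) = monomial (Finsupp.equivFunOnFinite.symm x)
        (∏ j, ((a j).choose (x j) : R) * v j ^ (a j - x j)) := by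
    rw [monomial_eq, Finset.prod_mul_distrib, map_prod, Finsupp.prod_fintype _ _ (by simp)]
    simp
  simp only [h1]
  rw [Finset.prod_univ_sum, coeff_sum]
  simp only [h2, coeff_monomial]
  by_cases he : e ≤ a
  · rw [Finset.sum_eq_single ⇑e]
    · simp [taylorEntry]
    · intro b _ hb
      rw [if_neg]
      rintro rfl
      exact hb (by simp)
    · intro h
      refine absurd ?_ h
      simpa [Fintype.mem_piFinset, Nat.lt_succ_iff] using fun j => he j
  · rw [taylorEntry_eq_zero v he]
    refine Finset.sum_eq_zero fun x hx => if_neg ?_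
    rintro rfl
    exact he fun j => by simpa [Nat.lt_succ_iff] using Fintype.mem_piFinset.1 hx j

lemma coeff_taylor {ι R : Type*} [Fintype ι] [CommSemiring R] (v : ι → R) (e : ι →₀ ℕ)
    (F : MvPolynomial ι R) :
    coeff e (aeval (fun j => C (v j) + X j : ι → MvPolynomial ι R) F) =
      ∑ a ∈ F.support, taylorEntry v e a * coeff a F := by
  conv_lhs => rw [F.as_sum, map_sum, coeff_sum]
  refine Finset.sum_congr rfl fun a _ => ?_
  rw [aeval_monomial, Finsupp.prod_fintype _ _ (by simp), algebraMap_eq, coeff_C_mul,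
    coeff_prod_C_add_X_pow, mul_comm]

lemma coeff_taylor_of_support_subset {ι R : Type*} [Fintype ι] [CommSemiring R] (v : ι → R)
    (e : ι →₀ ℕ) {F : MvPolynomial ι R} {S : Finset (ι →₀ ℕ)} (h : F.support ⊆ S) :
    coeff e (aeval (fun j => C (v j) + X j : ι → MvPolynomial ι R) F) =
      ∑ a ∈ S, taylorEntry v e a * coeff a F := by
  rw [coeff_taylor]
  exact Finset.sum_subset h fun a _ ha => by rw [notMem_support_iff.1 ha, mul_zero]

/-! ### Maximal minors and the passage from characteristic `p` to characteristic 0. -/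

/-- A matrix over a field whose columns are linearly independent has a nonzero maximal minor. -/
lemma exists_det_submatrix_ne_zero {k m n : Type*} [Field k] [Fintype n] [DecidableEq n]
    (A : Matrix m n k) (h : ∀ c, A.mulVec c = 0 → c = 0) :
    ∃ s : n → m, (A.submatrix s id).det ≠ 0 := by
  have hspan : Submodule.span k (Set.range A) = ⊤ := by
    -- If the rows do not span, a nonzero functional vanishes on them, and its values on the
    -- standard basis form a kernel vector.
    by_contra hne
    obtain ⟨f, hf, hle⟩ := Submodule.exists_le_ker_of_lt_top _ (lt_top_iff_ne_top.2 hne)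
    apply hf
    have key (w : n → k) : f w = ∑ j, w j * f (Pi.single j 1) := by
      conv_lhs => rw [pi_eq_sum_univ' w, map_sum]
      simp
    have hc : (fun j => f (Pi.single j 1)) = 0 := by
      refine h _ (funext fun i => ?_)
      have : f (A i) = 0 := hle (Submodule.subset_span ⟨i, rfl⟩)
      rw [key] at this
      exact this
    refine LinearMap.ext fun w => ?_
    rw [key]
    simp [fun j => congrFun hc j]
  obtain ⟨g, hg, -, hli⟩ := Submodule.exists_fun_fin_finrank_span_eq k (Set.range A)
  have hcard : Fintype.card n = Module.finrank k (Submodule.span k (Set.range A)) := by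
    rw [hspan, finrank_top, Module.finrank_fintype_fun_eq_card]
  choose t ht using hg
  refine ⟨fun j => t (Fintype.equivFinOfCardEq hcard j), ?_⟩
  rw [← isUnit_iff_ne_zero, ← Matrix.isUnit_iff_isUnit_det, ← Matrix.linearIndependent_rows_iff_isUnit]
  have : (A.submatrix (fun j => t (Fintype.equivFinOfCardEq hcard j)) id).row =
      g ∘ Fintype.equivFinOfCardEq hcard := by
    funext j
    exact ht _
  rw [this]
  exact hli.comp _ (Equiv.injective _)

lemma isWeightedHomogeneous_det {σ R M n : Type*} [CommRing R] [AddCommMonoid M] [Fintype n]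
    [DecidableEq n] {w : σ → M} (A : Matrix n n (MvPolynomial σ R)) (d : n → M)
    (h : ∀ i j, IsWeightedHomogeneous w (A i j) (d i)) :
    IsWeightedHomogeneous w A.det (∑ i, d i) := by
  rw [Matrix.det_apply]
  refine IsWeightedHomogeneous.sum _ _ _ fun τ _ => ?_
  rw [← Equiv.sum_comp τ d]
  have := IsWeightedHomogeneous.prod Finset.univ (fun i => A (τ i) i) (fun i => d (τ i))
    fun i _ => h _ _
  rw [Units.smul_def, ← mem_weightedHomogeneousSubmodule, ← Int.cast_smul_eq_zsmul R]
  exact Submodule.smul_mem _ _ this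

/-- The weights defining multihomogeneity. -/
abbrev groupWeight (r n : ℕ) (ij : Fin r × Fin (n + 1)) : Fin r → ℕ := Pi.single ij.1 1

/-- The multidegree depends on the row `(i, e)` but not on the column `a`, which is what makes the
minors multihomogeneous. -/
lemma isWeightedHomogeneous_taylorEntry_X {R : Type*} [CommSemiring R] {r n d : ℕ} (i : Fin r)
    (e a : Fin (n + 1) →₀ ℕ) (ha : a.degree = d) :
    IsWeightedHomogeneous (groupWeight r n)
      (taylorEntry (fun j => (X (i, j) : MvPolynomial (Fin r × Fin (n + 1)) R)) e a)
      (Pi.single i (d - e.degree)) := by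
  by_cases he : e ≤ a
  · have hd : (Pi.single i (d - e.degree) : Fin r → ℕ) =
        ∑ j, (0 + (a j - e j) • groupWeight r n (i, j)) := by
      have : d - e.degree = ∑ j, (a j - e j) := by
        rw [Finset.sum_tsub_distrib _ fun j _ => he j, ← Finsupp.degree_eq_sum,
          ← Finsupp.degree_eq_sum, ha]
      rw [this]
      simp only [zero_add, groupWeight, ← Pi.single_smul', smul_eq_mul, mul_one]
      exact map_sum (AddMonoidHom.single (fun _ : Fin r => ℕ) i) _ _
    rw [hd]
    refine IsWeightedHomogeneous.prod _ _ _ fun j _ => IsWeightedHomogeneous.mul ?_ ?_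
    · rw [← map_natCast (C : R →+* MvPolynomial (Fin r × Fin (n + 1)) R)]
      exact isWeightedHomogeneous_C _ _
    · exact (isWeightedHomogeneous_X R (groupWeight r n) (i, j)).pow _
  · rw [taylorEntry_eq_zero _ he]
    exact isWeightedHomogeneous_zero _ _ _

/-- If certain multiplicity conditions on polynomials with exponents in `S` only allow the zero
polynomial for one choice of points modulo a prime, they do so for general points in
characteristic zero. -/
lemma exists_isMultihomogeneous_of_zmod {K : Type*} [Field K] [CharZero K] {p r n d : ℕ}
    [Fact p.Prime] (m : Fin r → ℕ) (S : Finset (Fin (n + 1) →₀ ℕ)) (hS : ∀ a ∈ S, a.degree = d)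
    (v : Fin r → Fin (n + 1) → ZMod p)
    (h : ∀ c : (Fin (n + 1) →₀ ℕ) → ZMod p,
      (∀ i e, e.degree < m i → ∑ a ∈ S, taylorEntry (v i) e a * c a = 0) → ∀ a ∈ S, c a = 0) :
    ∃ f : MvPolynomial (Fin r × Fin (n + 1)) K, f ≠ 0 ∧ IsMultihomogeneous f ∧
      ∀ x : Fin r × Fin (n + 1) → K, eval x f ≠ 0 → ∀ c : (Fin (n + 1) →₀ ℕ) → K,
        (∀ i e, e.degree < m i → ∑ a ∈ S, taylorEntry (fun j => x (i, j)) e a * c a = 0) →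
          ∀ a ∈ S, c a = 0 := by
  classical
  let ρ := {ie : Fin r × (Fin (n + 1) →₀ ℕ) // ie.2.degree < m ie.1}
  let M : Matrix ρ S (MvPolynomial (Fin r × Fin (n + 1)) ℤ) := fun ie a =>
    taylorEntry (fun j => X (ie.1.1, j)) ie.1.2 a
  let φ : MvPolynomial (Fin r × Fin (n + 1)) ℤ →+* ZMod p :=
    eval₂Hom (Int.castRingHom (ZMod p)) fun ij => v ij.1 ij.2
  have hφ (ie : ρ) (a : S) : φ (M ie a) = taylorEntry (v ie.1.1) ie.1.2 a := by
    simp only [M, map_taylorEntry, φ, coe_eval₂Hom, eval₂_X]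
  obtain ⟨s, hs⟩ := exists_det_submatrix_ne_zero (M.map φ) fun c hc => by
    have := h (fun a => if ha : a ∈ S then c ⟨a, ha⟩ else 0) fun i e he => by
      rw [← Finset.sum_coe_sort]
      have := congrFun hc ⟨(i, e), he⟩
      simpa [Matrix.mulVec, dotProduct, hφ] using this
    funext a
    simpa using this a a.2
  -- The integral minor is nonzero because its specialization at `v` modulo `p` is.
  have hdet : (M.submatrix s id).det ≠ 0 := by
    intro h0
    apply hs
    have := φ.map_det (M.submatrix s id)
    rw [h0, map_zero] at this
    exact this.symm
  refine ⟨MvPolynomial.map (Int.castRingHom K) (M.submatrix s id).det, ?_, ?_, ?_⟩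
  · rw [Ne, map_eq_zero_iff _ (map_injective _ (RingHom.injective_int _))]
    exact hdet
  · refine ⟨∑ a, Pi.single (s a).1.1 (d - (s a).1.2.degree), fun e he => ?_⟩
    have hM (ie : ρ) (a : S) : IsWeightedHomogeneous (groupWeight r n) (M ie a)
        (Pi.single ie.1.1 (d - ie.1.2.degree)) :=
      isWeightedHomogeneous_taylorEntry_X _ _ _ (hS a a.2)
    refine isWeightedHomogeneous_det (M.submatrix s id) _ (fun a b => hM (s a) b) fun h0 => he ?_
    rw [coeff_map, h0, map_zero]
  · intro x hx c hc a ha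
    have hM (ie : ρ) (a : S) : ((eval x).comp (MvPolynomial.map (Int.castRingHom K))) (M ie a) =
        taylorEntry (fun j => x (ie.1.1, j)) ie.1.2 a := by
      simp only [M, map_taylorEntry, RingHom.comp_apply, map_X, eval_X]
    have hev : eval x (MvPolynomial.map (Int.castRingHom K) (M.submatrix s id).det) =
        (((eval x).comp (MvPolynomial.map (Int.castRingHom K))).mapMatrix
          (M.submatrix s id)).det := by
      rw [← RingHom.map_det]; rfl
    rw [hev] at hx
    have := Matrix.eq_zero_of_mulVec_eq_zero hx (v := fun a : S => c a) (funext fun b => by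
      have := hc (s b).1.1 (s b).1.2 (s b).2
      rw [← Finset.sum_coe_sort] at this
      refine Eq.trans (Finset.sum_congr rfl fun a _ => congrArg (· * c a) (hM _ _)) this)
    exact congrFun this ⟨a, ha⟩

/-! ### The special configuration modulo 13. -/

/-- At a coordinate point the multiplicity conditions kill single coefficients. -/
lemma coeff_eq_zero_of_taylorEntry_single {ι k : Type*} [Fintype ι] [DecidableEq ι]
    [CommSemiring k] {d m : ℕ} {S : Finset (ι →₀ ℕ)} (hS : ∀ a ∈ S, a.degree = d)
    (c : (ι →₀ ℕ) → k) (j : ι)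
    (h : ∀ e : ι →₀ ℕ, e.degree < m → ∑ a ∈ S, taylorEntry (Pi.single j 1) e a * c a = 0)
    {a : ι →₀ ℕ} (ha : a ∈ S) (haj : d < m + a j) : c a = 0 := by
  have hsplit (b : ι →₀ ℕ) : b j + (b.erase j).degree = b.degree := by
    rw [← Finsupp.degree_single j (b j), ← map_add, Finsupp.single_add_erase]
  have hdeg : (a.erase j).degree < m := by
    have := hsplit a
    rw [hS a ha] at this
    omega
  -- Test with `a.erase j`. A term `b` survives only if it agrees with `a` away from `j`, since the
  -- other coordinates of the point are 0; equality of degrees then gives `b = a`, whose entry is 1.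
  rw [← h _ hdeg, Finset.sum_eq_single a _ fun h => absurd ha h]
  · rw [taylorEntry, Finset.prod_eq_one, one_mul]
    intro i _
    by_cases hi : i = j
    · subst hi; simp
    · simp [Finsupp.erase_ne hi]
  · intro b hb hba
    obtain ⟨i, hij, hi⟩ : ∃ i, i ≠ j ∧ b i ≠ a i := by
      by_contra! hne
      apply hba
      have he : b.erase j = a.erase j := by
        ext i
        by_cases hi : i = j
        · subst hi; simp
        · rw [Finsupp.erase_ne hi, Finsupp.erase_ne hi, hne i hi]
      have hbj : b j = a j := by
        have h1 := hsplit a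
        have h2 := hsplit b
        rw [hS a ha] at h1
        rw [hS b hb, he] at h2
        omega
      rw [← Finsupp.single_add_erase j b, ← Finsupp.single_add_erase j a, he, hbj]
    rw [taylorEntry, Finset.prod_eq_zero (Finset.mem_univ i), zero_mul]
    rw [Finsupp.erase_ne hij, Pi.single_eq_of_ne hij]
    rcases lt_or_ge (b i) (a i) with hlt | hge
    · rw [Nat.choose_eq_zero_of_lt hlt, Nat.cast_zero, zero_mul]
    · rw [zero_pow (by omega), mul_zero]

/-- A quadruple as an exponent. -/
noncomputable def toExponent (t : ℕ × ℕ × ℕ × ℕ) : Fin 4 →₀ ℕ :=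
  Finsupp.equivFunOnFinite.symm ![t.1, t.2.1, t.2.2.1, t.2.2.2]

lemma toExponent_eta (a : Fin 4 →₀ ℕ) : toExponent (a 0, a 1, a 2, a 3) = a := by
  ext i
  fin_cases i <;> rfl

lemma degree_toExponent (t : ℕ × ℕ × ℕ × ℕ) :
    (toExponent t).degree = t.1 + t.2.1 + t.2.2.1 + t.2.2.2 := by
  rw [Finsupp.degree_eq_sum, Fin.sum_univ_four]
  rfl

lemma taylorEntry_toExponent {R : Type*} [CommSemiring R] (v e a : ℕ × ℕ × ℕ × ℕ) :
    taylorEntry (fun j => (toExponent v j : R)) (toExponent e) (toExponent a) =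
      (taylorNat v e a : R) := by
  rw [taylorEntry, Fin.prod_univ_four, taylorNat]
  push_cast
  rfl

lemma mem_exponents {t : ℕ × ℕ × ℕ × ℕ} : t ∈ exponents ↔
    t.1 < 4 ∧ t.2.1 < 6 ∧ t.2.2.1 < 6 ∧ 4 ≤ t.1 + t.2.1 + t.2.2.1 ∧
      t.1 + t.2.1 + t.2.2.1 ≤ 9 ∧ ¬ (t.1 = 3 ∧ 4 ≤ t.2.1) ∧
      t.2.2.2 = 9 - t.1 - t.2.1 - t.2.2.1 := by
  obtain ⟨a, b, c, d⟩ := t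
  simp only [exponents, List.mem_flatMap, List.mem_range]
  constructor
  · rintro ⟨a', ha, b', hb, c', hc, h⟩
    split_ifs at h with h'
    · obtain ⟨rfl, rfl, rfl, rfl⟩ : a = a' ∧ b = b' ∧ c = c' ∧ d = _ := by simpa using h
      exact ⟨ha, hb, hc, h'.1, h'.2.1, h'.2.2, rfl⟩
    · simp at h
  · rintro ⟨ha, hb, hc, h1, h2, h3, h4⟩
    refine ⟨a, ha, b, hb, c, hc, ?_⟩
    rw [if_pos ⟨h1, h2, h3⟩]
    simpa using h4

/-- Exponents of degree `9` apart from five that are divisible by `x₀³x₁⁴`. -/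
noncomputable def nonicExponents : Finset (Fin 4 →₀ ℕ) :=
  {a ∈ Finset.finsuppAntidiag Finset.univ 9 | ¬ (a 0 = 3 ∧ 4 ≤ a 1 ∧ a 1 ≤ 5)}

lemma mem_nonicExponents {a : Fin 4 →₀ ℕ} :
    a ∈ nonicExponents ↔ a.degree = 9 ∧ ¬ (a 0 = 3 ∧ 4 ≤ a 1 ∧ a 1 ≤ 5) := by
  simp [nonicExponents, Finsupp.degree_eq_sum]

lemma sum_nonicExponents {k : Type*} [AddCommMonoid k] (g : (Fin 4 →₀ ℕ) → k)
    (hg : ∀ a ∈ nonicExponents, (a 0, a 1, a 2, a 3) ∉ exponents → g a = 0) :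
    ∑ a ∈ nonicExponents, g a = (exponents.map fun t => g (toExponent t)).sum := by
  have hnd : exponents.Nodup := by decide +kernel
  rw [← List.sum_toFinset _ hnd]
  refine (Finset.sum_of_injOn toExponent ?_ ?_ ?_ fun _ _ => rfl).symm
  · intro s _ t _ hst
    have h (i : Fin 4) := DFunLike.congr_fun hst i
    have h0 := h 0
    have h1 := h 1
    have h2 := h 2
    have h3 := h 3
    exact Prod.ext h0 (Prod.ext h1 (Prod.ext h2 h3))
  · intro t ht
    have := mem_exponents.1 (List.mem_toFinset.1 ht)
    refine mem_nonicExponents.2 ⟨?_, fun h => this.2.2.2.2.2.1 ⟨h.1, h.2.1⟩⟩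
    rw [degree_toExponent]
    omega
  · intro a ha hna
    refine hg a ha fun hmem => hna ⟨_, List.mem_toFinset.2 hmem, toExponent_eta a⟩

/-- The four coordinate points and the five sample points, modulo `13`. -/
noncomputable def specialPoints : Fin 9 → Fin 4 → ZMod 13 :=
  Fin.append (m := 4) (n := 5) (fun i => Pi.single i 1)
    fun i j => (toExponent (samplePoints.get i) j : ZMod 13)

/-- The coordinate points remove every monomial outside `exponents`; the sample points remove the
remaining 99 by the computation. -/
lemma eq_zero_of_specialPoints (c : (Fin 4 →₀ ℕ) → ZMod 13)
    (h : ∀ (i : Fin 9) (e : Fin 4 →₀ ℕ), e.degree < (![6, 4, 4, 4, 4, 4, 4, 4, 4] : Fin 9 → ℕ) i →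
      ∑ a ∈ nonicExponents, taylorEntry (specialPoints i) e a * c a = 0) :
    ∀ a ∈ nonicExponents, c a = 0 := by
  have hS : ∀ a ∈ nonicExponents, a.degree = 9 := fun a ha => (mem_nonicExponents.1 ha).1
  have hcoord (j : Fin 4) (a) (ha : a ∈ nonicExponents)
      (hj : 9 < (![6, 4, 4, 4] : Fin 4 → ℕ) j + a j) : c a = 0 := by
    refine coeff_eq_zero_of_taylorEntry_single hS c j (fun e he => ?_) ha hj
    have hm : (![6, 4, 4, 4] : Fin 4 → ℕ) j =
        (![6, 4, 4, 4, 4, 4, 4, 4, 4] : Fin 9 → ℕ) (Fin.castAdd 5 j) := by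
      fin_cases j <;> rfl
    have := h (Fin.castAdd 5 j) e (hm ▸ he)
    rwa [specialPoints, Fin.append_left] at this
  have hout (a) (ha : a ∈ nonicExponents) (hna : (a 0, a 1, a 2, a 3) ∉ exponents) : c a = 0 := by
    obtain ⟨hdeg, hE⟩ := mem_nonicExponents.1 ha
    rw [Finsupp.degree_eq_sum, Fin.sum_univ_four] at hdeg
    by_contra hne
    have h0 : ¬ 9 < 6 + a 0 := fun hlt => hne (hcoord 0 a ha hlt)
    have h1 : ¬ 9 < 4 + a 1 := fun hlt => hne (hcoord 1 a ha hlt)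
    have h2 : ¬ 9 < 4 + a 2 := fun hlt => hne (hcoord 2 a ha hlt)
    have h3 : ¬ 9 < 4 + a 3 := fun hlt => hne (hcoord 3 a ha hlt)
    refine hna (mem_exponents.2 ⟨?_, ?_, ?_, ?_, ?_, ?_, ?_⟩) <;> dsimp only <;> omega
  have hin := eq_zero_of_taylorNat_sum_eq_zero (fun t => c (toExponent t)) fun v hv e he => by
    obtain ⟨i, hi⟩ : ∃ i : Fin 5, samplePoints.get i = v := List.mem_iff_get.1 hv
    have hv' : specialPoints (Fin.natAdd 4 i) = fun j => (toExponent v j : ZMod 13) := by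
      rw [← hi]
      exact Fin.append_right _ _ i
    have hdeg : (toExponent e).degree = 3 := by
      rw [degree_toExponent]
      revert e
      decide +kernel
    have hm : (toExponent e).degree <
        (![6, 4, 4, 4, 4, 4, 4, 4, 4] : Fin 9 → ℕ) (Fin.natAdd 4 i) := by
      rw [hdeg]
      clear hi hv'
      fin_cases i <;> decide
    have := h (Fin.natAdd 4 i) _ hm
    rw [hv', sum_nonicExponents _ fun a ha hna => by
      rw [hout a ha hna, mul_zero]] at this
    simpa only [taylorEntry_toExponent] using this
  intro a ha
  by_cases hmem : (a 0, a 1, a 2, a 3) ∈ exponents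
  · rw [← toExponent_eta a]
    exact hin _ hmem
  · exact hout a ha hmem

/-! ### Euler's relation and the virtual dimension. -/

lemma support_subset_finsuppAntidiag {ι R : Type*} [Fintype ι] [DecidableEq ι] [CommSemiring R]
    {F : MvPolynomial ι R} {d : ℕ} (hF : F.IsHomogeneous d) :
    F.support ⊆ Finset.finsuppAntidiag Finset.univ d := by
  intro a ha
  rw [Finset.mem_finsuppAntidiag]
  refine ⟨?_, Finset.subset_univ _⟩
  rw [← Finsupp.degree_eq_sum]
  by_contra h
  exact mem_support_iff.1 ha (hF.coeff_eq_zero h)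

/-- One variable at a time this is (a - e)·C(a, e) = (e + 1)·C(a, e + 1). Truncated subtraction is
harmless: both sides vanish when `a j ≤ e j`. -/
lemma sub_mul_taylorEntry {ι R : Type*} [Fintype ι] [DecidableEq ι] [CommRing R] (v : ι → R)
    (e a : ι →₀ ℕ) (j : ι) :
    ((a j - e j : ℕ) : R) * taylorEntry v e a =
      v j * (e j + 1) * taylorEntry v (e + Finsupp.single j 1) a := by
  rw [taylorEntry, taylorEntry, ← Finset.mul_prod_erase _ _ (Finset.mem_univ j),
    ← Finset.mul_prod_erase _ _ (Finset.mem_univ j)]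
  have h : ∏ i ∈ Finset.univ.erase j, (((a i).choose ((e + Finsupp.single j 1 : ι →₀ ℕ) i) : ℕ) : R) *
        v i ^ (a i - (e + Finsupp.single j 1 : ι →₀ ℕ) i) =
      ∏ i ∈ Finset.univ.erase j, (((a i).choose (e i) : ℕ) : R) * v i ^ (a i - e i) := by
    refine Finset.prod_congr rfl fun i hi => ?_
    rw [Finsupp.add_apply, Finsupp.single_eq_of_ne (Finset.ne_of_mem_erase hi), add_zero]
  rw [h, Finsupp.add_apply, Finsupp.single_eq_same]
  have hc : ((a j).choose (e j + 1) : R) * ((e j : R) + 1) =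
      ((a j).choose (e j) : R) * ((a j - e j : ℕ) : R) := by
    have := congrArg (Nat.cast : ℕ → R) (Nat.choose_succ_right_eq (a j) (e j))
    push_cast at this
    exact this
  have H : ((a j - e j : ℕ) : R) * (((a j).choose (e j) : R) * v j ^ (a j - e j)) =
      v j * (e j + 1) * (((a j).choose (e j + 1) : R) * v j ^ (a j - (e j + 1))) := by
    rcases Nat.lt_or_ge (e j) (a j) with hlt | hge
    · have hpow : v j ^ (a j - e j) = v j ^ (a j - (e j + 1)) * v j := by
        rw [← pow_succ]
        congr 1
        omega
      rw [hpow]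
      linear_combination -(v j * v j ^ (a j - (e j + 1))) * hc
    · rw [Nat.choose_eq_zero_of_lt (Nat.lt_succ_of_le hge), Nat.sub_eq_zero_of_le hge]
      simp
  rw [← mul_assoc, H, mul_assoc]

/-- Euler's relation for the Taylor coefficients: those of one degree determine those of the degree
below, up to the factor on the left. -/
lemma sub_degree_mul_taylorEntry {ι R : Type*} [Fintype ι] [DecidableEq ι] [CommRing R]
    (v : ι → R) (e a : ι →₀ ℕ) :
    ((a.degree - e.degree : ℕ) : R) * taylorEntry v e a =
      ∑ j, v j * (e j + 1) * taylorEntry v (e + Finsupp.single j 1) a := by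
  simp only [← sub_mul_taylorEntry, ← Finset.sum_mul]
  by_cases he : e ≤ a
  · rw [Finsupp.degree_eq_sum, Finsupp.degree_eq_sum, ← Finset.sum_tsub_distrib _ fun j _ => he j,
      Nat.cast_sum]
  · rw [taylorEntry_eq_zero _ he, mul_zero, mul_zero]

/-- For a form, vanishing of the Taylor coefficients of one degree implies vanishing of all the
coefficients of lower degree. -/
lemma hasMultAtLeast_succ_of_degree_eq {K : Type*} [Field K] [CharZero K] {n d m : ℕ}
    {F : MvPolynomial (Fin (n + 1)) K} (hF : F.IsHomogeneous d) (hm : m ≤ d) (p : ProjPoint K n)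
    (h : ∀ e ∈ Finset.finsuppAntidiag Finset.univ m,
      ∑ a ∈ Finset.finsuppAntidiag Finset.univ d, taylorEntry p.rep e a * coeff a F = 0) :
    HasMultAtLeast F p (m + 1) := by
  suffices H : ∀ k (e : Fin (n + 1) →₀ ℕ), e.degree + k = m →
      ∑ a ∈ Finset.finsuppAntidiag Finset.univ d, taylorEntry p.rep e a * coeff a F = 0 by
    intro e he
    rw [coeff_taylor_of_support_subset _ _ (support_subset_finsuppAntidiag hF)]
    exact H (m - e.degree) e (by omega)
  intro k
  induction k with
  | zero =>
    intro e he
    refine h e (Finset.mem_finsuppAntidiag.2 ⟨?_, Finset.subset_univ _⟩)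
    rw [← Finsupp.degree_eq_sum]
    exact he
  | succ k ih =>
    intro e he
    -- Here `e.degree < m ≤ d`, so the Euler factor is invertible in characteristic 0.
    have hne : ((d - e.degree : ℕ) : K) ≠ 0 := Nat.cast_ne_zero.2 (by omega)
    refine (mul_eq_zero.1 ?_).resolve_left hne
    rw [Finset.mul_sum]
    have : ∀ a ∈ Finset.finsuppAntidiag (Finset.univ : Finset (Fin (n + 1))) d,
        ((d - e.degree : ℕ) : K) * (taylorEntry p.rep e a * coeff a F) =
          ∑ j, p.rep j * (e j + 1) * (taylorEntry p.rep (e + Finsupp.single j 1) a * coeff a F) := by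
      intro a ha
      have had : a.degree = d := by
        rw [Finsupp.degree_eq_sum]; exact (Finset.mem_finsuppAntidiag.1 ha).1
      rw [← mul_assoc, ← had, sub_degree_mul_taylorEntry, Finset.sum_mul]
      simp only [mul_assoc]
    rw [Finset.sum_congr rfl this, Finset.sum_comm]
    refine Finset.sum_eq_zero fun j _ => ?_
    rw [← Finset.mul_sum, ih, mul_zero]
    rw [map_add, Finsupp.degree_single]
    omega

instance finite_linearSystem {K : Type*} [Field K] {n r : ℕ} (p : Fin r → ProjPoint K n) (d : ℕ)
    (m : Fin r → ℕ) : Module.Finite K (linearSystem p d m) := by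
  have : Module.Finite K (homogeneousSubmodule (Fin (n + 1)) K d) :=
    Module.Finite.iff_fg.2 (homogeneousSubmodule_fg _ _ d)
  have hle : linearSystem p d m ≤ homogeneousSubmodule (Fin (n + 1)) K d := fun F hF => hF.1
  exact Submodule.finiteDimensional_of_le hle

/-- The dimension of a linear system is at least the virtual one. -/
lemma card_le_finrank_linearSystem_add {K : Type*} [Field K] [CharZero K] {n r : ℕ}
    (p : Fin r → ProjPoint K n) (d : ℕ) (m : Fin r → ℕ) (hm : ∀ i, m i ≤ d) :
    (n + d).choose d ≤ Module.finrank K (linearSystem p d fun i => m i + 1) +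
      ∑ i, (n + m i).choose (m i) := by
  classical
  let D (k : ℕ) : Finset (Fin (n + 1) →₀ ℕ) := Finset.finsuppAntidiag Finset.univ k
  have hD (k : ℕ) : Fintype.card (D k) = (n + k).choose k := by
    rw [Fintype.card_coe, Finset.card_finsuppAntidiag_nat_eq_choose, Finset.card_univ,
      Fintype.card_fin]
    congr 1
    omega
  let Φ : (D d → K) →ₗ[K] MvPolynomial (Fin (n + 1)) K := ∑ a, monomial a.1 ∘ₗ LinearMap.proj a
  have hΦ (c : D d → K) (a : D d) : coeff a.1 (Φ c) = c a := by
    simp [Φ, coeff_sum, coeff_monomial]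
  -- `T` imposes only the conditions of exact degree `m i`; Euler's relation supplies the lower
  -- ones, so multiplicity `m i + 1` costs `(n + m i).choose (m i)` conditions.
  let T : (D d → K) →ₗ[K] ((Σ i, D (m i)) → K) :=
    LinearMap.pi fun ie => ∑ a, taylorEntry (p ie.1).rep ie.2.1 a.1 • LinearMap.proj a
  have hinj : Function.Injective (Φ.domRestrict T.ker) := by
    intro c c' h
    ext a
    rw [← hΦ c, ← hΦ c']
    exact congrArg _ h
  have hle : (T.ker).map Φ ≤ linearSystem p d fun i => m i + 1 := by
    rintro _ ⟨c, hc, rfl⟩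
    have hhom : (Φ c).IsHomogeneous d := by
      simp only [Φ, LinearMap.sum_apply, LinearMap.comp_apply]
      refine IsHomogeneous.sum _ _ _ fun a _ => isHomogeneous_monomial _ ?_
      rw [Finsupp.degree_eq_sum]
      exact (Finset.mem_finsuppAntidiag.1 a.2).1
    refine ⟨hhom, fun i => hasMultAtLeast_succ_of_degree_eq hhom (hm i) _ fun e he => ?_⟩
    have := congrFun (LinearMap.mem_ker.1 hc) ⟨i, e, he⟩
    rw [← Finset.sum_coe_sort]
    simpa [T, hΦ] using this
  have h1 := Submodule.finrank_mono hle
  rw [← LinearMap.range_domRestrict, LinearMap.finrank_range_of_inj hinj] at h1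
  have h2 := T.finrank_range_add_finrank_ker
  have h3 := T.range.finrank_le
  rw [Module.finrank_fintype_fun_eq_card, Fintype.card_sigma] at h3
  rw [Module.finrank_fintype_fun_eq_card, hD] at h2
  simp only [hD] at h3
  omega

/-! ### Multiplication by a fixed form. -/

lemma HasMultAtLeast.mul {K : Type*} [Field K] {n a b : ℕ} {F G : MvPolynomial (Fin (n + 1)) K}
    {p : ProjPoint K n} (hF : HasMultAtLeast F p a) (hG : HasMultAtLeast G p b) :
    HasMultAtLeast (F * G) p (a + b) := by
  intro e he
  rw [map_mul, coeff_mul]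
  refine Finset.sum_eq_zero fun x hx => ?_
  rw [← Finset.HasAntidiagonal.mem_antidiagonal.1 hx, map_add] at he
  rcases Nat.lt_or_ge x.1.degree a with h | h
  · rw [hF _ h, zero_mul]
  · rw [hG _ (by omega), mul_zero]

lemma addFixed_linearSystem_le {K : Type*} [Field K] {n r d d' : ℕ} {p : Fin r → ProjPoint K n}
    {m m' : Fin r → ℕ} {q : MvPolynomial (Fin (n + 1)) K} (hq : q ∈ linearSystem p d m) :
    addFixed q (linearSystem p d' m') ≤ linearSystem p (d + d') (m + m') := by
  rintro _ ⟨G, hG, rfl⟩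
  exact ⟨hq.1.mul hG.1, fun i => (hq.2 i).mul (hG.2 i)⟩

lemma finrank_addFixed {K : Type*} [Field K] {n : ℕ} {q : MvPolynomial (Fin (n + 1)) K}
    (hq : q ≠ 0) (M : Submodule K (MvPolynomial (Fin (n + 1)) K)) :
    Module.finrank K (addFixed q M) = Module.finrank K M :=
  (LinearEquiv.finrank_eq (Submodule.equivMapOfInjective (LinearMap.mulLeft K q)
    (mul_right_injective₀ hq) M)).symm

/-- Over an algebraically closed field two forms `q`, `q'` with `q + M = q' + M` for a nonzero
finite-dimensional system `M` are proportional. -/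
lemma mem_span_of_addFixed_eq {K : Type*} [Field K] [IsAlgClosed K] {n : ℕ}
    {q q' : MvPolynomial (Fin (n + 1)) K} (hq : q ≠ 0)
    {M : Submodule K (MvPolynomial (Fin (n + 1)) K)} [Module.Finite K M] (hM : M ≠ ⊥)
    (h : addFixed q' M ≤ addFixed q M) : q' ∈ Submodule.span K {q} := by
  have : Nontrivial M := Submodule.nontrivial_iff_ne_bot.2 hM
  let E : M ≃ₗ[K] addFixed q M :=
    Submodule.equivMapOfInjective (LinearMap.mulLeft K q) (mul_right_injective₀ hq) M
  -- `T` is multiplication by q'/q.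
  let T : Module.End K M := E.symm.toLinearMap ∘ₗ
    ((LinearMap.mulLeft K q').restrict fun g hg => h ⟨g, hg, rfl⟩ : M →ₗ[K] addFixed q M)
  have hT (g : M) : q * (T g : MvPolynomial (Fin (n + 1)) K) = q' * g := by
    change ((E (T g) : addFixed q M) : MvPolynomial (Fin (n + 1)) K) = _
    simp only [T, LinearMap.comp_apply, LinearEquiv.coe_coe, LinearEquiv.apply_symm_apply]
    rfl
  obtain ⟨μ, hμ⟩ := Module.End.exists_eigenvalue T
  obtain ⟨g, hg⟩ := hμ.exists_hasEigenvector
  have hg0 : (g : MvPolynomial (Fin (n + 1)) K) ≠ 0 := fun h0 => hg.2 (Subtype.ext h0)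
  have := hT g
  rw [hg.apply_eq_smul, Submodule.coe_smul, mul_smul_comm, ← smul_mul_assoc] at this
  exact Submodule.mem_span_singleton.2 ⟨μ, mul_right_cancel₀ hg0 this⟩

/-! ### The bound 5 and the equality of the two systems. -/

/-- The exponents of degree `9` that are not in `nonicExponents`. -/
def freeExponents : List (ℕ × ℕ × ℕ × ℕ) :=
  [(3, 4, 0, 2), (3, 4, 1, 1), (3, 4, 2, 0), (3, 5, 0, 1), (3, 5, 1, 0)]

/-- The five coefficients at `freeExponents` separate the elements of `V`: where they all vanish,
the support lies in `nonicExponents`. -/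
lemma finrank_le_five_of_nonicExponents {K : Type*} [Field K]
    {V : Submodule K (MvPolynomial (Fin 4) K)} (hV : ∀ F ∈ V, F.IsHomogeneous 9)
    (h : ∀ F ∈ V, F.support ⊆ nonicExponents → F = 0) : Module.finrank K V ≤ 5 := by
  let T : V →ₗ[K] Fin 5 → K :=
    LinearMap.pi fun i => lcoeff K (toExponent (freeExponents.get i)) ∘ₗ V.subtype
  have hT : Function.Injective T := by
    rw [← LinearMap.ker_eq_bot, LinearMap.ker_eq_bot']
    intro F hF
    refine Subtype.ext (h F F.2 fun a ha => ?_)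
    have hdeg : a.degree = 9 := by
      by_contra hne
      exact mem_support_iff.1 ha ((hV F F.2).coeff_eq_zero hne)
    refine mem_nonicExponents.2 ⟨hdeg, fun ⟨h0, h1, h2⟩ => mem_support_iff.1 ha ?_⟩
    obtain ⟨i, hi⟩ : ∃ i : Fin 5, freeExponents.get i = (a 0, a 1, a 2, a 3) := by
      suffices (a 0, a 1, a 2, a 3) ∈ freeExponents from List.mem_iff_get.1 this
      rw [Finsupp.degree_eq_sum, Fin.sum_univ_four, h0] at hdeg
      have h3 : a 3 = 6 - a 1 - a 2 := by omega
      have h2 : a 2 ≤ 6 - a 1 := by omega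
      rw [h0, h3]
      generalize a 1 = x at *
      generalize a 2 = y at *
      interval_cases x <;> interval_cases y <;> decide
    have := congrFun hF i
    rw [← toExponent_eta a, ← hi]
    exact this
  have := LinearMap.finrank_le_finrank_of_injective hT
  rwa [Module.finrank_fin_fun] at this

/-- For general points the system of nonic forms has the dimension of the system of septics. -/
lemma exists_finrank_linearSystem_le_five (K : Type*) [Field K] [CharZero K] :
    ∃ f : MvPolynomial (Fin 9 × Fin 4) K, f ≠ 0 ∧ IsMultihomogeneous f ∧
      ∀ p : Fin 9 → ProjPoint K 3, eval (fun ij => (p ij.1).rep ij.2) f ≠ 0 →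
        Module.finrank K (linearSystem p 9 ![6, 4, 4, 4, 4, 4, 4, 4, 4]) ≤ 5 := by
  have : Fact (Nat.Prime 13) := ⟨by norm_num⟩
  obtain ⟨f, hf, hmul, h⟩ := exists_isMultihomogeneous_of_zmod (K := K) _ nonicExponents
    (fun a ha => (mem_nonicExponents.1 ha).1) specialPoints eq_zero_of_specialPoints
  refine ⟨f, hf, hmul, fun p hp => finrank_le_five_of_nonicExponents (fun F hF => hF.1) ?_⟩
  intro F hF hsupp
  have := h _ hp (fun a => coeff a F) fun i e he => by
    rw [← hF.2 i e he, coeff_taylor_of_support_subset _ _ hsupp]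
  ext a
  by_cases ha : a ∈ nonicExponents
  · exact this a ha
  · exact notMem_support_iff.1 fun h' => ha (hsupp h')

lemma span_singleton_and_eq_addFixed_of_finrank_le {K : Type*} [Field K] [IsAlgClosed K]
    [CharZero K] {p : Fin 9 → ProjPoint K 3}
    (hp : Module.finrank K (linearSystem p 9 ![6, 4, 4, 4, 4, 4, 4, 4, 4]) ≤ 5) :
    ∃ q : MvPolynomial (Fin 4) K, q ≠ 0 ∧
      linearSystem p 2 ![1, 1, 1, 1, 1, 1, 1, 1, 1] = Submodule.span K {q} ∧
      linearSystem p 9 ![6, 4, 4, 4, 4, 4, 4, 4, 4] ≠ ⊥ ∧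
      linearSystem p 9 ![6, 4, 4, 4, 4, 4, 4, 4, 4] =
        addFixed q (linearSystem p 7 ![5, 3, 3, 3, 3, 3, 3, 3, 3]) := by
  have h7 : 5 ≤ Module.finrank K (linearSystem p 7 ![5, 3, 3, 3, 3, 3, 3, 3, 3]) := by
    -- The listed numbers are the multiplicities minus one; the count is 120 - (35 + 8·10) = 5.
    have := card_le_finrank_linearSystem_add p 7 ![4, 2, 2, 2, 2, 2, 2, 2, 2] (by decide)
    have hm : (fun i => (![4, 2, 2, 2, 2, 2, 2, 2, 2] : Fin 9 → ℕ) i + 1) =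
      ![5, 3, 3, 3, 3, 3, 3, 3, 3] := by decide
    have hs : ∑ i, (3 + (![4, 2, 2, 2, 2, 2, 2, 2, 2] : Fin 9 → ℕ) i).choose
      ((![4, 2, 2, 2, 2, 2, 2, 2, 2] : Fin 9 → ℕ) i) = 115 := by decide +kernel
    have hc : (3 + 7).choose 7 = 120 := by decide +kernel
    rw [hm, hs, hc] at this
    omega
  have h2 : 1 ≤ Module.finrank K (linearSystem p 2 ![1, 1, 1, 1, 1, 1, 1, 1, 1]) := by
    have := card_le_finrank_linearSystem_add p 2 ![0, 0, 0, 0, 0, 0, 0, 0, 0] (by decide)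
    have hm : (fun i => (![0, 0, 0, 0, 0, 0, 0, 0, 0] : Fin 9 → ℕ) i + 1) =
      ![1, 1, 1, 1, 1, 1, 1, 1, 1] := by decide
    have hs : ∑ i, (3 + (![0, 0, 0, 0, 0, 0, 0, 0, 0] : Fin 9 → ℕ) i).choose
      ((![0, 0, 0, 0, 0, 0, 0, 0, 0] : Fin 9 → ℕ) i) = 9 := by decide +kernel
    have hc : (3 + 2).choose 2 = 10 := by decide +kernel
    rw [hm, hs, hc] at this
    omega
  have hadd : (![1, 1, 1, 1, 1, 1, 1, 1, 1] + ![5, 3, 3, 3, 3, 3, 3, 3, 3] : Fin 9 → ℕ) =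
    ![6, 4, 4, 4, 4, 4, 4, 4, 4] := by decide
  have key {q : MvPolynomial (Fin 4) K} (hq : q ∈ linearSystem p 2 ![1, 1, 1, 1, 1, 1, 1, 1, 1])
      (hq0 : q ≠ 0) : addFixed q (linearSystem p 7 ![5, 3, 3, 3, 3, 3, 3, 3, 3]) =
        linearSystem p 9 ![6, 4, 4, 4, 4, 4, 4, 4, 4] := by
    refine Submodule.eq_of_le_of_finrank_le ?_ ?_
    · have := addFixed_linearSystem_le (d' := 7) (m' := ![5, 3, 3, 3, 3, 3, 3, 3, 3]) hq
      rwa [hadd] at this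
    · rw [finrank_addFixed hq0]
      -- 5 bounds the larger space from above and the smaller one from below.
      exact hp.trans h7
  have hne {V : Submodule K (MvPolynomial (Fin 4) K)} (hV : 1 ≤ Module.finrank K V) : V ≠ ⊥ := by
    rintro rfl
    simp at hV
  obtain ⟨q, hq, hq0⟩ := Submodule.exists_mem_ne_zero_of_ne_bot (hne h2)
  refine ⟨q, hq0, le_antisymm (fun q' hq' => ?_) ?_, ?_, (key hq hq0).symm⟩
  · by_cases h0 : q' = 0
    · rw [h0]; exact zero_mem _
    · exact mem_span_of_addFixed_eq hq0 (hne (le_trans (by norm_num) h7)) ((key hq' h0).trans (key hq hq0).symm).le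
  · rwa [Submodule.span_singleton_le_iff_mem]
  · rw [← key hq hq0]
    refine hne ?_
    rw [finrank_addFixed hq0]
    omega

/-! ### Nonempty open sets from nonzero multihomogeneous polynomials. -/

lemma eval_mul_of_isWeightedHomogeneous {K : Type*} [Field K] {r n : ℕ}
    {f : MvPolynomial (Fin r × Fin (n + 1)) K} {d : Fin r → ℕ}
    (hf : f.IsWeightedHomogeneous (groupWeight r n) d) (a : Fin r → K)
    (x : Fin r × Fin (n + 1) → K) :
    eval (fun ij => a ij.1 * x ij) f = (∏ i, a i ^ d i) * eval x f := by
  rw [eval_eq', eval_eq', Finset.mul_sum]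
  refine Finset.sum_congr rfl fun e he => ?_
  have hd : ∀ i, ∑ j, e (i, j) = d i := by
    intro i
    rw [← hf (mem_support_iff.1 he), Finsupp.weight_apply, Finsupp.sum_fintype _ _ (by simp),
      Finset.sum_apply, Fintype.sum_prod_type, Finset.sum_eq_single i]
    · simp
    · intro k _ hk
      simp [Pi.single_eq_of_ne hk.symm]
    · simp
  simp only [mul_pow, Finset.prod_mul_distrib, ← hd, Finset.prod_pow_eq_pow_sum,
    Fintype.prod_prod_type]
  ring

lemma exists_eval_rep_ne_zero {K : Type*} [Field K] [Infinite K] {r n : ℕ}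
    {f : MvPolynomial (Fin r × Fin (n + 1)) K} (hf : f ≠ 0) (hm : IsMultihomogeneous f) :
    ∃ p : Fin r → ProjPoint K n, eval (fun ij => (p ij.1).rep ij.2) f ≠ 0 := by
  obtain ⟨d, hd⟩ := hm
  -- The extra factor makes the first coordinate of every group nonzero, so each group represents a
  -- point.
  have hne : f * ∏ i, X (i, (0 : Fin (n + 1))) ≠ 0 :=
    mul_ne_zero hf (Finset.prod_ne_zero_iff.2 fun i _ => X_ne_zero _)
  obtain ⟨x, hx⟩ : ∃ x, eval x (f * ∏ i, X (i, (0 : Fin (n + 1)))) ≠ 0 := by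
    by_contra! h
    exact hne (MvPolynomial.funext fun x => by rw [h x, map_zero])
  rw [map_mul, map_prod] at hx
  have hv (i : Fin r) : (fun j => x (i, j)) ≠ 0 := by
    intro h0
    have := Finset.prod_ne_zero_iff.1 (right_ne_zero_of_mul hx) i (Finset.mem_univ i)
    rw [eval_X] at this
    exact this (congrFun h0 0)
  choose a ha using fun i => Projectivization.exists_smul_eq_mk_rep K _ (hv i)
  refine ⟨fun i => Projectivization.mk K _ (hv i), ?_⟩
  have : (fun ij : Fin r × Fin (n + 1) => (Projectivization.mk K _ (hv ij.1)).rep ij.2) =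
      fun ij => (a ij.1 : K) * x ij := by
    funext ij
    rw [← ha]
    rfl
  rw [this, eval_mul_of_isWeightedHomogeneous hd (fun i => (a i : K))]
  exact mul_ne_zero (Finset.prod_ne_zero_iff.2 fun i _ => pow_ne_zero _ (a i).ne_zero)
    (left_ne_zero_of_mul hx)

lemma forGeneralPoints_of_eval_ne_zero {K : Type*} [Field K] [Infinite K] {r n : ℕ}
    {P : (Fin r → ProjPoint K n) → Prop} {f : MvPolynomial (Fin r × Fin (n + 1)) K} (hf : f ≠ 0)
    (hm : IsMultihomogeneous f)
    (h : ∀ p : Fin r → ProjPoint K n, eval (fun ij => (p ij.1).rep ij.2) f ≠ 0 → P p) :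
    ForGeneralPoints P := by
  refine ⟨{p | ∀ g ∈ ({f} : Set (MvPolynomial (Fin r × Fin (n + 1)) K)),
    eval (fun ij => (p ij.1).rep ij.2) g = 0}, ⟨{f}, ?_, rfl⟩, ?_, fun p hp => h p ?_⟩
  · rintro g rfl
    exact hm
  · obtain ⟨p, hp⟩ := exists_eval_rep_ne_zero hf hm
    exact fun huniv => hp (Set.eq_univ_iff_forall.1 huniv p f rfl)
  · intro h0
    exact hp (by rintro g rfl; exact h0)

/-! ### Irreducibility of the quadric. -/

/-- No four of the points are coplanar, for general points. -/
lemma exists_det_rep_ne_zero (K : Type*) [Field K] (r n : ℕ) :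
    ∃ f : MvPolynomial (Fin r × Fin (n + 1)) K, f ≠ 0 ∧ IsMultihomogeneous f ∧
      ∀ p : Fin r → ProjPoint K n, eval (fun ij => (p ij.1).rep ij.2) f ≠ 0 →
        ∀ s : Fin (n + 1) ↪ Fin r, (Matrix.of fun a b => (p (s a)).rep b).det ≠ 0 := by
  let A (s : Fin (n + 1) ↪ Fin r) :
      Matrix (Fin (n + 1)) (Fin (n + 1)) (MvPolynomial (Fin r × Fin (n + 1)) K) :=
    Matrix.of fun a b => X (s a, b)
  have hev (x : Fin r × Fin (n + 1) → K) (s) :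
      eval x (A s).det = (Matrix.of fun a b => x (s a, b)).det := by
    rw [RingHom.map_det]
    congr 1
    ext a b
    simp [A]
  refine ⟨∏ s, (A s).det, ?_, ⟨∑ s : Fin (n + 1) ↪ Fin r, ∑ a, Pi.single (s a) 1, ?_⟩,
    fun p hp s => ?_⟩
  · refine Finset.prod_ne_zero_iff.2 fun s _ h0 => ?_
    -- Evaluate where the point of index `s b` is the `b`-th basis vector, so that the matrix
    -- becomes the identity.
    have h1 := hev (fun ij => if ij.1 = s ij.2 then 1 else 0) s
    have h2 : (Matrix.of fun a b => if s a = s b then (1 : K) else 0) = 1 := by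
      ext a b
      simp [Matrix.one_apply]
    rw [h0, map_zero, h2, Matrix.det_one] at h1
    exact zero_ne_one h1
  · exact IsWeightedHomogeneous.prod _ _ _ fun s _ =>
      isWeightedHomogeneous_det _ _ fun a b => isWeightedHomogeneous_X K _ (s a, b)
  · rw [map_prod] at hp
    have := Finset.prod_ne_zero_iff.1 hp s (Finset.mem_univ s)
    rwa [hev] at this

lemma HasMultAtLeast.eval_eq_zero {K : Type*} [Field K] {n m : ℕ}
    {F : MvPolynomial (Fin (n + 1)) K} {p : ProjPoint K n} (h : HasMultAtLeast F p (m + 1)) :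
    eval p.rep F = 0 := by
  have := h 0 (by simp)
  rw [coeff_taylor] at this
  rw [eval_eq', ← this]
  refine Finset.sum_congr rfl fun a _ => ?_
  simp [taylorEntry, mul_comm]

/-- A nonzero linear form vanishes in at most `n` of the points if no `n + 1` of them are linearly
dependent. -/
lemma card_filter_eval_eq_zero_le {K : Type*} [Field K] [DecidableEq K] {r n : ℕ}
    {p : Fin r → ProjPoint K n}
    (hp : ∀ s : Fin (n + 1) ↪ Fin r, (Matrix.of fun a b => (p (s a)).rep b).det ≠ 0)
    {l : MvPolynomial (Fin (n + 1)) K} (hl : l.IsHomogeneous 1) (hl0 : l ≠ 0) :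
    (Finset.univ.filter fun i => eval (p i).rep l = 0).card ≤ n := by
  by_contra! hcard
  obtain ⟨t, ht, htc⟩ := Finset.exists_subset_card_eq (Nat.succ_le_of_lt hcard)
  let s : Fin (n + 1) ↪ Fin r :=
    (t.equivFinOfCardEq htc).symm.toEmbedding.trans (Function.Embedding.subtype _)
  have hs (a) : eval (p (s a)).rep l = 0 :=
    (Finset.mem_filter.1 (ht ((t.equivFinOfCardEq htc).symm a).2)).2
  have hspan : l ∈ homogeneousSubmodule (Fin (n + 1)) K 1 := hl
  rw [homogeneousSubmodule_one_eq_span_X, Submodule.mem_span_range_iff_exists_fun] at hspan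
  obtain ⟨c, rfl⟩ := hspan
  have hc : c = 0 := by
    refine Matrix.eq_zero_of_mulVec_eq_zero (hp s) (funext fun a => ?_)
    have := hs a
    simp only [map_sum, smul_eval, eval_X] at this
    simpa [Matrix.mulVec, dotProduct, mul_comm] using this
  exact hl0 (by simp [hc])

/-- Irreducibility concerns arbitrary polynomial factors; comparing components of degree 2 replaces
them by linear forms. -/
lemma eq_homogeneousComponent_mul {K : Type*} [Field K] {ι : Type*} {a b : MvPolynomial ι K}
    (hab : (a * b).IsHomogeneous 2) (ha : a.totalDegree = 1) (hb : b.totalDegree = 1) :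
    a * b = homogeneousComponent 1 a * homogeneousComponent 1 b := by
  have hsplit {f : MvPolynomial ι K} (hf : f.totalDegree = 1) :
      f = C (coeff 0 f) + homogeneousComponent 1 f := by
    conv_lhs => rw [← sum_homogeneousComponent f, hf]
    simp [Finset.sum_range_succ]
  have ha1 := homogeneousComponent_isHomogeneous 1 a
  have hb1 := homogeneousComponent_isHomogeneous 1 b
  set a₁ := homogeneousComponent 1 a
  set b₁ := homogeneousComponent 1 b
  set α := coeff 0 a
  set β := coeff 0 b
  have h : a * b = C (α * β) + (C α * b₁ + C β * a₁) + a₁ * b₁ := by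
    rw [hsplit ha, hsplit hb, C_mul]
    ring
  have h2 := congrArg (homogeneousComponent 2) h
  rw [map_add, map_add, homogeneousComponent_of_mem hab,
    homogeneousComponent_of_mem (isHomogeneous_C _ (α * β)),
    homogeneousComponent_of_mem ((hb1.C_mul α).add (ha1.C_mul β)),
    homogeneousComponent_of_mem (ha1.mul hb1)] at h2
  simpa using h2

lemma irreducible_of_mem_linearSystem_two {K : Type*} [Field K] {p : Fin 9 → ProjPoint K 3}
    (hp : ∀ s : Fin 4 ↪ Fin 9, (Matrix.of fun a b => (p (s a)).rep b).det ≠ 0)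
    {q : MvPolynomial (Fin 4) K} (hq : q.IsHomogeneous 2) (hqp : ∀ i, eval (p i).rep q = 0)
    (hq0 : q ≠ 0) : Irreducible q := by
  classical
  have hunit {f : MvPolynomial (Fin 4) K} (hf : f ≠ 0) (h : f.totalDegree = 0) : IsUnit f := by
    rw [totalDegree_eq_zero_iff_eq_C] at h
    rw [h] at hf ⊢
    exact (isUnit_iff_ne_zero.2 fun h0 => hf (by rw [h0, C_0])).map C
  refine ⟨fun hu => ?_, fun a b hab => ?_⟩
  · obtain ⟨c, -, hc⟩ := isUnit_iff_eq_C_of_isReduced.1 hu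
    have := hq.totalDegree hq0
    rw [hc, totalDegree_C] at this
    omega
  · subst hab
    have ha0 := left_ne_zero_of_mul hq0
    have hb0 := right_ne_zero_of_mul hq0
    have hdeg := hq.totalDegree hq0
    rw [totalDegree_mul_of_isDomain ha0 hb0] at hdeg
    by_contra! hcon
    have ha : a.totalDegree ≠ 0 := fun h => hcon.1 (hunit ha0 h)
    have hb : b.totalDegree ≠ 0 := fun h => hcon.2 (hunit hb0 h)
    have heq := eq_homogeneousComponent_mul hq (by omega) (by omega)
    rw [heq] at hq0 hqp
    have h1 := card_filter_eval_eq_zero_le hp (homogeneousComponent_isHomogeneous 1 a)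
      (left_ne_zero_of_mul hq0)
    have h2 := card_filter_eval_eq_zero_le hp (homogeneousComponent_isHomogeneous 1 b)
      (right_ne_zero_of_mul hq0)
    -- Every point lies on one of the two planes, which gives 9 ≤ 3 + 3.
    have hcov : (Finset.univ : Finset (Fin 9)) ⊆
        (Finset.univ.filter fun i => eval (p i).rep (homogeneousComponent 1 a) = 0) ∪
          Finset.univ.filter fun i => eval (p i).rep (homogeneousComponent 1 b) = 0 := by
      intro i _
      have := hqp i
      rw [map_mul, mul_eq_zero] at this
      simpa using this
    have := (Finset.card_le_card hcov).trans (Finset.card_union_le _ _)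
    rw [Finset.card_univ, Fintype.card_fin] at this
    omega

end FatPoints

theorem mainTheorem1 (K : Type*) [Field K] [IsAlgClosed K] [CharZero K] :
    FatPoints.ForGeneralPoints (fun p : Fin 9 → FatPoints.ProjPoint K 3 =>
      ∃ q : MvPolynomial (Fin 4) K,
        FatPoints.linearSystem p 2 ![1, 1, 1, 1, 1, 1, 1, 1, 1] = Submodule.span K {q} ∧
        FatPoints.IsFixedComponent q
          (FatPoints.linearSystem p 9 ![6, 4, 4, 4, 4, 4, 4, 4, 4]) ∧
        FatPoints.linearSystem p 9 ![6, 4, 4, 4, 4, 4, 4, 4, 4] =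
          FatPoints.addFixed q
            (FatPoints.linearSystem p 7 ![5, 3, 3, 3, 3, 3, 3, 3, 3])) := by
  obtain ⟨f, hf, ⟨d, hd⟩, h⟩ := FatPoints.exists_finrank_linearSystem_le_five K
  obtain ⟨g, hg, ⟨e, he⟩, h'⟩ := FatPoints.exists_det_rep_ne_zero K 9 3
  refine FatPoints.forGeneralPoints_of_eval_ne_zero (mul_ne_zero hf hg) ⟨d + e, hd.mul he⟩
    fun p hp => ?_
  rw [map_mul] at hp
  obtain ⟨q, hq0, hspan, hne, hadd⟩ :=
    FatPoints.span_singleton_and_eq_addFixed_of_finrank_le (h p (left_ne_zero_of_mul hp))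
  have hq : q ∈ FatPoints.linearSystem p 2 ![1, 1, 1, 1, 1, 1, 1, 1, 1] :=
    hspan ▸ Submodule.mem_span_singleton_self q
  have hone (i : Fin 9) : (![1, 1, 1, 1, 1, 1, 1, 1, 1] : Fin 9 → ℕ) i = 0 + 1 := by
    fin_cases i <;> rfl
  have hirr : Irreducible q := FatPoints.irreducible_of_mem_linearSystem_two
    (h' p (right_ne_zero_of_mul hp)) hq.1 (fun i => (hone i ▸ hq.2 i).eval_eq_zero) hq0
  refine ⟨q, hspan, ⟨hirr, hne, fun F hF => ?_⟩, hadd⟩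
  rw [hadd] at hF
  obtain ⟨G, -, rfl⟩ := hF
  exact ⟨G, rfl⟩
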